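/- Let $\mathcal Y\subset\mathbb R^h$ be compact, let $n\in\mathbb N$, and let $\Omega,W:\mathcal Y\times\mathcal Y\to\mathbb R$. Let $f_0,\dots,f_n$ be jointly measurable real random fields on $\mathcal Y$, and $\omega_0,\dots,\omega_{n-1}$ real random fields on $\mathcal Y$, all on one probability space, forming a linear Gaussian dynamical system: for each $0\le t<n$ and each $\zeta\in\mathcal Y$, almost surely $$f_{t+1}(\zeta)=(\Omega f_t)(\zeta)+\omega_t(\zeta),\qquad (\Omega u)(\zeta)=\int_{\mathcal Y}\Omega(\zeta,\zeta')u(\zeta')\,d\zeta',$$ where $f_0$ is a centred Gaussian process, $\omega_t\sim\mathcal{GP}(0,W)$, and $\omega_t$ is independent of $f_t$. Put $\Psi_t(\zeta_1,\zeta_2)=\mathbb E[f_t(\zeta_1)f_t(\zeta_2)]$. Assume: 1. $\Omega$ and $W$ are Lipschitz in each argument, with constants $L_\Omega$ and $L_W$ that do not depend on the other argument; $\Psi_0$ is Lipschitz in each argument, uniformly in the other. 2. For some $C\in(0,1)$, $\|\Omega u-\Omega v\|_{L^2(\mathcal Y)}\le C\|u-v\|_{L^2(\mathcal Y)}$ for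 all $u,v\in L^2(\mathcal Y)$. 3. $W$ is positive semidefinite: $\sum_{i,j=1}^d c_ic_jW(\zeta_i,\zeta_j)\ge0$ for all $d\in\mathbb N$, $\zeta_1,\dots,\zeta_d\in\mathcal Y$, $c\in\mathbb R^d$. 4. For $1\le t\le n$, $\Psi_t$ is positive definite: $\sum_{i,j=1}^d c_ic_j\Psi_t(\zeta_i,\zeta_j)>0$ for all $d\in\mathbb N$, pairwise distinct $\zeta_1,\dots,\zeta_d\in\mathcal Y$ and $c\in\mathbb R^d\setminus\{0\}$. Then: (a) for $0\le t\le n$ and $\zeta\in\mathcal Y$, $f_t(\zeta)$ is square integrable with mean $0$ (so $\Psi_t$ is the covariance kernel of $f_t$), and for $0\le t<n$ $$\Psi_{t+1}=\Omega\Psi_t\Omega'+W,\qquad (\Omega\Psi_t\Omega')(\zeta_1,\zeta_2)=\int_{\mathcal Y}\int_{\mathcal Y}\Omega(\zeta_1,\eta_1)\Psi_t(\eta_1,\eta_2)\Omega(\zeta_2,\eta_2)\,d\eta_2\,d\eta_1;$$ (b) for $0\le t\le n$, $\Psi_t$ is Lipschitz in each argument, uniformly in the other; (c) for $0\le t\le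 n$, $f_t$ is almost surely continuous on $\mathcal Y$: it has a modification all of whose sample paths are continuous, and if $f_t$ is separable then its own sample paths are almost surely continuous. (Here $f_t$ is separable if there is a countable $D\subset\mathcal Y$ such that, almost surely, for every $\zeta\in\mathcal Y$ the point $(\zeta,f_t(\zeta))$ lies in the closure of $\{(\eta,f_t(\eta)):\eta\in D\}$.) -/

import Mathlib

open MeasureTheory ProbabilityTheory
open scoped NNReal ENNReal

noncomputable section

namespace LGDS

/-- `K` is Lipschitz in each of its two arguments, with constant `L` uniform in the other one. -/
def IsLipschitzKernel {Y : Type*} [PseudoMetricSpace Y] (L : ℝ≥0) (K : Y → Y → ℝ) : Prop :=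
  (∀ y, LipschitzWith L (fun x => K x y)) ∧ (∀ x, LipschitzWith L (fun y => K x y))

/-- Positive semidefinite kernel. -/
def IsPosSemidefKernel {Y : Type*} (K : Y → Y → ℝ) : Prop :=
  ∀ (d : ℕ) (x : Fin d → Y) (c : Fin d → ℝ), 0 ≤ ∑ i, ∑ j, c i * c j * K (x i) (x j)

/-- (Strictly) positive definite kernel: distinct points, coefficients not all zero. -/
def IsPosDefKernel {Y : Type*} (K : Y → Y → ℝ) : Prop :=
  ∀ (d : ℕ) (x : Fin d → Y) (c : Fin d → ℝ), Function.Injective x → c ≠ 0 →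
    0 < ∑ i, ∑ j, c i * c j * K (x i) (x j)

/-- Lebesgue measure on a subset `Y` of `ℝ^h`, as a measure on the subtype. -/
def lebesgueOn {h : ℕ} (Y : Set (EuclideanSpace ℝ (Fin h))) : Measure Y :=
  Measure.comap (Subtype.val : Y → EuclideanSpace ℝ (Fin h)) volume

/-- The integral operator `(Ω u)(ζ) = ∫ Ω(ζ, ζ') u(ζ') μ(dζ')`. -/
def kernelOp {Y : Type*} [MeasurableSpace Y] (μ : Measure Y) (Ω : Y → Y → ℝ) (u : Y → ℝ) (ζ : Y) : ℝ :=
  ∫ ζ', Ω ζ ζ' * u ζ' ∂μ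

/-- The kernel `(Ω K Ω')(ζ₁, ζ₂) = ∬ Ω(ζ₁, η₁) K(η₁, η₂) Ω(ζ₂, η₂) μ(dη₁) μ(dη₂)`. -/
def kernelConj {Y : Type*} [MeasurableSpace Y] (μ : Measure Y) (Ω K : Y → Y → ℝ)
    (ζ₁ ζ₂ : Y) : ℝ :=
  ∫ η₁, ∫ η₂, Ω ζ₁ η₁ * K η₁ η₂ * Ω ζ₂ η₂ ∂μ ∂μ

/-- The integral operator with kernel `Ω` is a contraction of `L²(μ)` with constant `C`. -/
def IsContractingKernel {Y : Type*} [MeasurableSpace Y] (μ : Measure Y) (C : ℝ)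
    (Ω : Y → Y → ℝ) : Prop :=
  ∀ u v : Y → ℝ, MemLp u 2 μ → MemLp v 2 μ →
    eLpNorm (fun ζ => kernelOp μ Ω u ζ - kernelOp μ Ω v ζ) 2 μ
      ≤ ENNReal.ofReal C * eLpNorm (fun ζ => u ζ - v ζ) 2 μ

/-- The covariance function `(ζ₁, ζ₂) ↦ E[X(ζ₁) X(ζ₂)]` of a centred random field. -/
def covKernel {Y S : Type*} [MeasurableSpace S] (P : Measure S) (X : Y → S → ℝ)
    (ζ₁ ζ₂ : Y) : ℝ :=
  ∫ s, X ζ₁ s * X ζ₂ s ∂P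

/-- `X ∼ GP(0, K)`. -/
structure IsCenteredGP {Y S : Type*} [MeasurableSpace S] (P : Measure S) (X : Y → S → ℝ)
    (K : Y → Y → ℝ) : Prop where
  gaussian : IsGaussianProcess X P
  mean_zero : ∀ ζ, ∫ s, X ζ s ∂P = 0
  cov_eq : ∀ ζ₁ ζ₂, covKernel P X ζ₁ ζ₂ = K ζ₁ ζ₂

/-- `f` is the state, up to time `n`, of the linear Gaussian dynamical system
`f_{t+1} = Ω f_t + ω_t` with noise `ω_t ∼ GP(0, W)` independent of the current state `f_t`
and centred Gaussian initial state. -/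
structure IsLGDS {Y S : Type*} [MeasurableSpace Y] [MeasurableSpace S] (μ : Measure Y)
    (P : Measure S) (n : ℕ) (Ω W : Y → Y → ℝ) (f ω : ℕ → Y → S → ℝ) : Prop where
  measurable : ∀ t ≤ n, Measurable (fun p : Y × S => f t p.1 p.2)
  initial : IsCenteredGP P (f 0) (covKernel P (f 0))
  noise : ∀ t < n, IsCenteredGP P (ω t) W
  indep : ∀ t < n, IndepFun (fun s ζ => f t ζ s) (fun s ζ => ω t ζ s) P
  dynamics : ∀ t < n, ∀ ζ, ∀ᵐ s ∂P,
    f (t + 1) ζ s = kernelOp μ Ω (fun ζ' => f t ζ' s) ζ + ω t ζ s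

/-- Some version (modification) of the random field `X` has only continuous sample paths. -/
def HasContinuousVersion {Y S : Type*} [TopologicalSpace Y] [MeasurableSpace S] (P : Measure S)
    (X : Y → S → ℝ) : Prop :=
  ∃ g : Y → S → ℝ, (∀ ζ, Measurable (g ζ)) ∧ (∀ s, Continuous (fun ζ => g ζ s)) ∧
    ∀ ζ, ∀ᵐ s ∂P, g ζ s = X ζ s

/-- Separability of a random field (in the sense of Doob): almost surely, the whole sample path
is determined through limits by its values on a fixed countable set. -/
def IsSeparableField {Y S : Type*} [TopologicalSpace Y] [MeasurableSpace S] (P : Measure S)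
    (X : Y → S → ℝ) : Prop :=
  ∃ D : Set Y, D.Countable ∧ ∀ᵐ s ∂P, ∀ ζ : Y,
    (ζ, X ζ s) ∈ closure ((fun η => (η, X η s)) '' D)

end LGDS

end

/-! Everything follows from one induction on `t`, carrying two facts together: `f t` is a centred
Gaussian process, and its covariance is Lipschitz in each argument. The second fact makes `f t`
mean-square continuous, with `E (f_t(x) - f_t(y))² ≤ 2 L |x - y|`, and this is what keeps
Gaussianity alive. A linear combination of values of `f (t + 1)` is an integral of `f t` against a
bounded weight plus a combination of noise values. Sampling `f t` on dyadic grids makes the integral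
an `L²`-limit of finite Gaussian sums, each independent of the noise, and `L²`-limits of centred
Gaussians are centred Gaussian (`hasGaussianLaw_weighted_integral_add`). The covariance recursion is
Fubini plus the vanishing of cross terms by independence (`covKernel_transition`). In `Ω Ψ Ω'` the
outer variable enters only through the Lipschitz kernel `Ω`, integrated against a bounded function
over a finite measure, so the Lipschitz property propagates (`IsCenteredGP.transition`). Continuity
is Kolmogorov chaining (`hasContinuousVersion_of_tail`): Gaussian increments with variance of order
`2⁻ᵏ` exceed `(3/4)ᵏ` with probability below any prescribed geometric rate, by high moments, which
beats the exponential number of grid pairs in any dimension. -/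

namespace LGDS

open Filter Topology

/-! ### Centred Gaussian variables: limits, moments, linear images. -/

section Gaussian

variable {S : Type*} [MeasurableSpace S] {P : Measure S}

lemma map_eq_gaussianReal_of_mean_zero {Z : S → ℝ} (hZ : HasGaussianLaw Z P)
    (h0 : ∫ s, Z s ∂P = 0) :
    P.map Z = gaussianReal 0 (∫ s, Z s ^ 2 ∂P).toNNReal := by
  rw [hZ.map_eq_gaussianReal, h0, variance_of_integral_eq_zero hZ.aemeasurable h0]

/-- An `L²`-limit of centred Gaussian random variables is a centred Gaussian random variable. -/
lemma hasGaussianLaw_of_tendsto_eLpNorm [IsProbabilityMeasure P] {Z : ℕ → S → ℝ} {Z' : S → ℝ}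
    (hZ : ∀ k, HasGaussianLaw (Z k) P) (h0 : ∀ k, ∫ s, Z k s ∂P = 0) (hZ' : MemLp Z' 2 P)
    (hlim : Tendsto (fun k => eLpNorm (Z k - Z') 2 P) atTop (𝓝 0)) :
    HasGaussianLaw Z' P ∧ ∫ s, Z' s ∂P = 0 := by
  have hdist : TendstoInDistribution Z atTop Z' (fun _ => P) P :=
    (tendstoInMeasure_of_tendsto_eLpNorm (by norm_num)
      (fun k => (hZ k).memLp_two.1) hZ'.1 hlim).tendstoInDistribution
      (fun k => (hZ k).aemeasurable)
  have hchar := ProbabilityMeasure.tendsto_iff_tendsto_charFun.1 hdist.tendsto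
  have hLp : Tendsto (fun k => (hZ k).memLp_two.toLp (Z k)) atTop (𝓝 (hZ'.toLp Z')) :=
    (Lp.tendsto_Lp_iff_tendsto_eLpNorm'' _ (fun k => (hZ k).memLp_two) _ hZ').2 hlim
  have hsq : ∀ {U : S → ℝ} (hU : MemLp U 2 P), ‖hU.toLp U‖ ^ 2 = ∫ s, U s ^ 2 ∂P := by
    intro U hU
    rw [← real_inner_self_eq_norm_sq, L2.inner_def]
    refine integral_congr_ae ?_
    filter_upwards [hU.coeFn_toLp] with s hs
    simp [hs, sq]
  have hvar : Tendsto (fun k => ∫ s, Z k s ^ 2 ∂P) atTop (𝓝 (∫ s, Z' s ^ 2 ∂P)) := by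
    simpa only [hsq] using (hLp.norm.pow 2)
  have hmap : P.map Z' = gaussianReal 0 (∫ s, Z' s ^ 2 ∂P).toNNReal := by
    have := Measure.isProbabilityMeasure_map (μ := P) hZ'.1.aemeasurable
    -- The characteristic functions of `Z k` have two limits: that of `Z'`, by convergence in
    -- distribution, and the Gaussian one, since the variances converge.
    refine Measure.ext_of_charFun (funext fun t => ?_)
    refine tendsto_nhds_unique (hchar t) ?_
    simp only [ProbabilityMeasure.coe_mk, map_eq_gaussianReal_of_mean_zero (hZ _) (h0 _)]
    simp only [charFun_gaussianReal]
    refine (Complex.continuous_exp.tendsto _).comp ?_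
    refine Tendsto.sub tendsto_const_nhds (Tendsto.div_const (Tendsto.mul_const _ ?_) _)
    exact (Complex.continuous_ofReal.tendsto _).comp
      ((NNReal.continuous_coe.tendsto _).comp ((continuous_real_toNNReal.tendsto _).comp hvar))
  refine ⟨⟨by rw [hmap]; infer_instance⟩, ?_⟩
  have := integral_map (μ := P) hZ'.1.aemeasurable (f := fun x : ℝ => x) (by fun_prop)
  rw [← this, hmap, integral_id_gaussianReal]

/-- Markov's inequality for the moment of order `2 q` of a centred Gaussian random variable. -/
lemma measure_le_abs_le_of_gaussian [IsProbabilityMeasure P] {Z : S → ℝ} (hZ : HasGaussianLaw Z P)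
    (h0 : ∫ s, Z s ∂P = 0) {v a : ℝ} (hv : ∫ s, Z s ^ 2 ∂P ≤ v) (ha : 0 < a) (q : ℕ) :
    P {s | a ≤ |Z s|} ≤
      ENNReal.ofReal ((∫ x, x ^ (2 * q) ∂gaussianReal 0 1) * (v / a ^ 2) ^ q) := by
  have hV : 0 ≤ ∫ s, Z s ^ 2 ∂P := integral_nonneg fun s => sq_nonneg _
  -- `Z` is in law its standard deviation times a standard Gaussian, so its moment of order `2 q` is
  -- the `q`-th power of the variance times a universal constant.
  have hmap : P.map Z = (gaussianReal 0 1).map (√(∫ s, Z s ^ 2 ∂P) * ·) := by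
    rw [map_eq_gaussianReal_of_mean_zero hZ h0, gaussianReal_map_const_mul]
    congr 1
    · simp
    · ext; simp [Real.sq_sqrt hV, hV]
  have hm : ∫ s, Z s ^ (2 * q) ∂P
      = (∫ s, Z s ^ 2 ∂P) ^ q * ∫ x, x ^ (2 * q) ∂gaussianReal 0 1 := by
    rw [← integral_map (μ := P) hZ.aemeasurable (f := fun x : ℝ => x ^ (2 * q)) (by fun_prop),
      hmap, integral_map (by fun_prop) (by fun_prop), ← integral_const_mul]
    simp only [mul_pow, pow_mul, Real.sq_sqrt hV]
  have hint : Integrable (fun s => Z s ^ (2 * q)) P := by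
    have := (hZ.memLp (p := (2 * q : ℕ)) (ENNReal.natCast_ne_top _)).integrable_norm_pow'
    simpa [pow_mul] using this
  have hmar := mul_meas_ge_le_integral_of_nonneg
    (ae_of_all P fun s => (by rw [pow_mul]; positivity : 0 ≤ Z s ^ (2 * q))) hint (a ^ (2 * q))
  have hmom : 0 ≤ ∫ x, x ^ (2 * q) ∂gaussianReal 0 1 :=
    integral_nonneg fun x => by simp only [pow_mul, Pi.zero_apply]; positivity
  rw [← ofReal_measureReal]
  refine ENNReal.ofReal_le_ofReal ?_
  have hsub : P.real {s | a ≤ |Z s|} ≤ P.real {s | a ^ (2 * q) ≤ Z s ^ (2 * q)} := by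
    refine measureReal_mono fun s hs => ?_
    have := pow_le_pow_left₀ ha.le hs (2 * q)
    rwa [pow_mul |Z s|, sq_abs, ← pow_mul] at this
  have hapos : 0 < a ^ (2 * q) := by positivity
  rw [hm] at hmar
  calc P.real {s | a ≤ |Z s|} ≤ P.real {s | a ^ (2 * q) ≤ Z s ^ (2 * q)} := hsub
    _ ≤ ((∫ s, Z s ^ 2 ∂P) ^ q * ∫ x, x ^ (2 * q) ∂gaussianReal 0 1) / a ^ (2 * q) := by
      rw [le_div_iff₀ hapos, mul_comm]; exact hmar
    _ ≤ (v ^ q * ∫ x, x ^ (2 * q) ∂gaussianReal 0 1) / a ^ (2 * q) := by gcongr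
    _ = _ := by rw [div_pow, ← pow_mul]; ring

/-- A random vector is Gaussian as soon as all its continuous linear images are. -/
lemma hasGaussianLaw_of_dual {E : Type*} [NormedAddCommGroup E] [NormedSpace ℝ E]
    [MeasurableSpace E] [BorelSpace E] {Z : S → E} (hZ : AEMeasurable Z P)
    (h : ∀ L : StrongDual ℝ E, HasGaussianLaw (fun s => L (Z s)) P) : HasGaussianLaw Z P where
  isGaussian_map := ⟨fun L => by
    have hL : Measurable L := L.continuous.measurable
    rw [AEMeasurable.map_map_of_aemeasurable hL.aemeasurable hZ,
      integral_map hZ (by fun_prop), variance_map (by fun_prop) hZ]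
    exact (h L).map_eq_gaussianReal⟩

end Gaussian

/-! ### Kolmogorov chaining and separable fields. -/

section Continuity

variable {S : Type*} [MeasurableSpace S] {P : Measure S}

/-- Almost surely, the events `E k` of geometrically small probability occur finitely often. -/
lemma ae_eventually_not_of_geometric {p : ℕ → S → Prop} {M r : ℝ} (hr0 : 0 ≤ r) (hr1 : r < 1)
    (h : ∀ k, P {s | p k s} ≤ ENNReal.ofReal (M * r ^ k)) :
    ∀ᵐ s ∂P, ∀ᶠ k in atTop, ¬ p k s :=
  ae_eventually_notMem (s := fun k => {s | p k s}) (ne_top_of_le_ne_top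
    ((summable_geometric_of_lt_one hr0 hr1).mul_left M).tsum_ofReal_ne_top
    (ENNReal.tsum_le_tsum h))

/-- A **Kolmogorov continuity criterion**: the index set is approximated by finite sets of
exponentially growing cardinality, and increments over distances `≲ 2⁻ᵏ` exceed `(3/4)ᵏ` with
probability decaying faster than any exponential rate. -/
lemma hasContinuousVersion_of_tail {Y : Type*} [PseudoMetricSpace Y] {X : Y → S → ℝ}
    (hX : ∀ x, Measurable (X x)) (π : ℕ → Y → Y) (N : ℕ → Finset Y) {A B c : ℝ}
    (hB : 0 < B) (hc : 0 ≤ c)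
    (hπN : ∀ k x, π k x ∈ N k) (hN : ∀ k, ((N k).card : ℝ) ≤ A * B ^ k)
    (hπ : ∀ k x, dist (π k x) x ≤ c * (1 / 2) ^ k)
    (htail : ∀ r : ℝ, 0 < r → ∃ M : ℝ, 0 ≤ M ∧ ∀ k x y, dist x y ≤ (2 * c + 1) * (1 / 2) ^ k →
      P {s | (3 / 4 : ℝ) ^ k ≤ |X x s - X y s|} ≤ ENNReal.ofReal (M * r ^ k)) :
    HasContinuousVersion P X := by
  classical
  -- Two levels are joined so that `Q k` controls both the chaining links from `π k x` to `π (k + 1)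
  -- x` and the pairs `π k x`, `π k y` with `dist x y < 2⁻ᵏ`; the latter need the radius `2 c + 1`.
  let T : ℕ → Finset Y := fun k => N k ∪ N (k + 1)
  let Q : ℕ → Finset (Y × Y) := fun k =>
    (T k ×ˢ T k).filter fun p => dist p.1 p.2 ≤ (2 * c + 1) * (1 / 2) ^ k
  let bad : ℕ → S → Prop := fun k s => ∃ p ∈ Q k, (3 / 4 : ℝ) ^ k ≤ |X p.1 s - X p.2 s|
  have hbadmeas : ∀ k, MeasurableSet {s | bad k s} := by
    intro k
    have : {s | bad k s} = ⋃ p ∈ Q k, {s | (3 / 4 : ℝ) ^ k ≤ |X p.1 s - X p.2 s|} := by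
      ext s; simp [bad]
    rw [this]
    exact Finset.measurableSet_biUnion _ fun p _ =>
      measurableSet_le measurable_const ((hX p.1).sub (hX p.2)).abs
  have hA : 0 ≤ A := by simpa using (Nat.cast_nonneg _).trans (hN 0)
  have hT : ∀ k, ((T k).card : ℝ) ≤ A * (1 + B) * B ^ k := by
    intro k
    calc ((T k).card : ℝ) ≤ (N k).card + (N (k + 1)).card := by
          exact_mod_cast Finset.card_union_le _ _
      _ ≤ A * B ^ k + A * B ^ (k + 1) := add_le_add (hN k) (hN (k + 1))
      _ = _ := by ring
  have hQ : ∀ k, ((Q k).card : ℝ) ≤ (A * (1 + B)) ^ 2 * (B ^ 2) ^ k := by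
    intro k
    calc ((Q k).card : ℝ) ≤ (T k).card * (T k).card := by
          exact_mod_cast (Finset.card_filter_le _ _).trans (Finset.card_product _ _).le
      _ ≤ (A * (1 + B) * B ^ k) * (A * (1 + B) * B ^ k) := by
          gcongr <;> exact hT k
      _ = _ := by rw [← pow_mul, mul_comm 2 k, pow_mul]; ring
  have hbad : ∀ᵐ s ∂P, ∀ᶠ k in atTop, ¬ bad k s := by
    -- There are of the order of `B ^ (2 k)` pairs; this rate cancels them and leaves a summable
    -- `2⁻ᵏ`.
    obtain ⟨M, hM0, hM⟩ := htail (1 / (2 * B ^ 2)) (by positivity)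
    refine ae_eventually_not_of_geometric (M := (A * (1 + B)) ^ 2 * M) (r := 1 / 2)
      (by norm_num) (by norm_num) fun k => ?_
    have : {s | bad k s} = ⋃ p ∈ Q k, {s | (3 / 4 : ℝ) ^ k ≤ |X p.1 s - X p.2 s|} := by
      ext s; simp [bad]
    calc P {s | bad k s}
        ≤ ∑ p ∈ Q k, P {s | (3 / 4 : ℝ) ^ k ≤ |X p.1 s - X p.2 s|} := by
          rw [this]; exact measure_biUnion_finset_le _ _
      _ ≤ ∑ p ∈ Q k, ENNReal.ofReal (M * (1 / (2 * B ^ 2)) ^ k) :=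
          Finset.sum_le_sum fun p hp => hM k _ _ (Finset.mem_filter.1 hp).2
      _ = ENNReal.ofReal ((Q k).card * (M * (1 / (2 * B ^ 2)) ^ k)) := by
          rw [Finset.sum_const, nsmul_eq_mul, ENNReal.ofReal_mul (p := ((Q k).card : ℝ))
            (by positivity), ENNReal.ofReal_natCast]
      _ ≤ ENNReal.ofReal
            ((A * (1 + B)) ^ 2 * (B ^ 2) ^ k * (M * (1 / (2 * B ^ 2)) ^ k)) := by
          gcongr; exact hQ k
      _ = ENNReal.ofReal ((A * (1 + B)) ^ 2 * M * (1 / 2) ^ k) := by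
          congr 1
          rw [show (1 / (2 * B ^ 2)) ^ k = (1 / 2) ^ k / (B ^ 2) ^ k by
            rw [← div_pow]; congr 1; field_simp]
          field_simp
  let G : Set S := {s | ∀ᶠ k in atTop, ¬ bad k s}
  have hGmeas : MeasurableSet G := by
    have : G = ⋃ K, ⋂ k ∈ Set.Ici K, {s | bad k s}ᶜ := by
      ext s; simp [G, eventually_atTop]
    rw [this]
    exact MeasurableSet.iUnion fun K => MeasurableSet.biInter (Set.to_countable _)
      fun k _ => (hbadmeas k).compl
  have hclose : ∀ {k s}, ¬ bad k s → ∀ {x y}, x ∈ T k → y ∈ T k →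
      dist x y ≤ (2 * c + 1) * (1 / 2) ^ k → dist (X x s) (X y s) ≤ (3 / 4 : ℝ) ^ k := by
    intro k s hs x y hx hy hxy
    by_contra hcon
    exact hs ⟨(x, y), by simp only [Q, Finset.mem_filter, Finset.mem_product]; exact ⟨⟨hx, hy⟩, hxy⟩,
      by rw [← Real.dist_eq]; exact (not_le.1 hcon).le⟩
  have hstep : ∀ {k s}, ¬ bad k s → ∀ x, dist (X (π k x) s) (X (π (k + 1) x) s) ≤ (3 / 4 : ℝ) ^ k := by
    intro k s hs x
    refine hclose hs (Finset.mem_union_left _ (hπN k x)) (Finset.mem_union_right _ (hπN (k + 1) x)) ?_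
    have h1 := dist_triangle_right (π k x) (π (k + 1) x) x
    have h2 := hπ k x
    have h3 := hπ (k + 1) x
    have h4 : (0 : ℝ) < (1 / 2) ^ k := by positivity
    have h5 : c * (1 / 2 : ℝ) ^ (k + 1) ≤ c * (1 / 2) ^ k := by
      rw [pow_succ]; nlinarith [mul_nonneg hc h4.le]
    nlinarith
  have hgeom : ∀ {s K}, (∀ k ≥ K, ¬ bad k s) → ∀ x k, dist (X (π (k + K) x) s)
      (X (π (k + 1 + K) x) s) ≤ (3 / 4 : ℝ) ^ K * (3 / 4) ^ k := by
    intro s K hK x k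
    have := hstep (hK (k + K) (by omega)) x
    rwa [pow_add, mul_comm, add_right_comm] at this
  -- Cutting off outside the measurable event `G` makes the limit exist for every sample, so `g` is
  -- measurable and all its paths are continuous (zero off `G`).
  let u : ℕ → Y → S → ℝ := fun k x => G.indicator (X (π k x))
  have hconv : ∀ x s, ∃ l, Tendsto (fun k => u k x s) atTop (𝓝 l) := by
    intro x s
    by_cases hs : s ∈ G
    · obtain ⟨K, hK⟩ := eventually_atTop.1 hs
      obtain ⟨l, hl⟩ := cauchySeq_tendsto_of_complete
        (cauchySeq_of_le_geometric _ _ (by norm_num) (hgeom hK x))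
      exact ⟨l, by simpa [u, hs] using (tendsto_add_atTop_iff_nat K).1 hl⟩
    · exact ⟨0, by simp [u, hs]⟩
  choose g hg using hconv
  have hgG : ∀ {s}, s ∈ G → ∀ x, Tendsto (fun k => X (π k x) s) atTop (𝓝 (g x s)) := by
    intro s hs x
    simpa [u, hs] using hg x s
  refine ⟨g, fun x => ?_, fun s => ?_, fun x => ?_⟩
  · exact measurable_of_tendsto_metrizable
      (f := fun k => u k x) (fun k => (hX _).indicator hGmeas) (tendsto_pi_nhds.2 (hg x))
  · by_cases hs : s ∈ G
    · obtain ⟨K, hK⟩ := eventually_atTop.1 hs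
      -- The factor 4 is the geometric sum `1 / (1 - 3/4)`. The 9 below is `4 + 1 + 4`: two such
      -- tails and one grid increment.
      have hfar : ∀ k ≥ K, ∀ x, dist (X (π k x) s) (g x s) ≤ 4 * (3 / 4 : ℝ) ^ k := by
        intro k hk x
        have := dist_le_of_le_geometric_of_tendsto₀ _ _ (by norm_num)
          (hgeom (fun j hj => hK j (hk.trans hj)) x)
          ((tendsto_add_atTop_iff_nat k).2 (hgG hs x))
        norm_num at this ⊢
        linarith
      refine Metric.continuous_iff.2 fun x ε hε => ?_
      have hlim : Tendsto (fun k : ℕ => 9 * (3 / 4 : ℝ) ^ k) atTop (𝓝 0) := by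
        simpa using (tendsto_pow_atTop_nhds_zero_of_lt_one
          (by norm_num : (0 : ℝ) ≤ 3 / 4) (by norm_num)).const_mul 9
      obtain ⟨k, hkε, hkK⟩ := ((hlim.eventually_lt_const hε).and (eventually_ge_atTop K)).exists
      refine ⟨(1 / 2) ^ k, by positivity, fun y hy => ?_⟩
      have h1 := hfar k hkK x
      have h2 := hfar k hkK y
      have h3 : dist (X (π k y) s) (X (π k x) s) ≤ (3 / 4 : ℝ) ^ k := by
        refine hclose (hK k hkK) (Finset.mem_union_left _ (hπN k y))
          (Finset.mem_union_left _ (hπN k x)) ?_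
        have := dist_triangle4_right (π k y) (π k x) y x
        have := hπ k x
        have := hπ k y
        nlinarith
      have h4 := dist_triangle4 (g y s) (X (π k y) s) (X (π k x) s) (g x s)
      rw [dist_comm (g y s) (X (π k y) s)] at h4
      linarith
    · have : ∀ x, g x s = 0 := fun x =>
        tendsto_nhds_unique (hg x s) (by simp [u, hs])
      simpa [this] using continuous_const
  -- For fixed `x`, Borel–Cantelli gives `X (π k x) → X x` almost surely; the limit is also `g x`.
  · obtain ⟨M, hM0, hM⟩ := htail (1 / 2) (by norm_num)
    have hx : ∀ᵐ s ∂P, ∀ᶠ k in atTop, ¬ (3 / 4 : ℝ) ^ k ≤ |X (π k x) s - X x s| := by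
      refine ae_eventually_not_of_geometric (by norm_num) (by norm_num) fun k => hM k _ _ ?_
      refine (hπ k x).trans ?_
      gcongr
      linarith
    filter_upwards [hx, hbad] with s hs hsG
    refine tendsto_nhds_unique (hgG hsG x) (tendsto_iff_dist_tendsto_zero.2 ?_)
    refine squeeze_zero' (Eventually.of_forall fun _ => dist_nonneg) ?_
      (tendsto_pow_atTop_nhds_zero_of_lt_one (by norm_num : (0 : ℝ) ≤ 3 / 4) (by norm_num))
    filter_upwards [hs] with k hk
    rw [Real.dist_eq]
    exact (not_le.1 hk).le

/-- A separable field with a continuous version has almost surely continuous sample paths. -/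
lemma ae_continuous_of_isSeparableField {Y : Type*} [TopologicalSpace Y] {X : Y → S → ℝ}
    (h : HasContinuousVersion P X) (hsep : IsSeparableField P X) :
    ∀ᵐ s ∂P, Continuous fun ζ => X ζ s := by
  obtain ⟨g, -, hgc, hgX⟩ := h
  obtain ⟨D, hD, hDX⟩ := hsep
  filter_upwards [hDX, (ae_ball_iff hD).2 fun ζ _ => hgX ζ] with s hs hgD
  have hgraph : IsClosed {p : Y × ℝ | g p.1 s = p.2} :=
    isClosed_eq ((hgc s).comp continuous_fst) continuous_snd
  have : (fun ζ => X ζ s) = fun ζ => g ζ s := by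
    funext ζ
    have hsub : (fun η => (η, X η s)) '' D ⊆ {p : Y × ℝ | g p.1 s = p.2} := by
      rintro _ ⟨η, hη, rfl⟩
      exact hgD η hη
    exact (closure_minimal hsub hgraph (hs ζ)).symm
  rw [this]
  exact hgc s

end Continuity

/-! ### Dyadic grids. -/

/-- Dyadic discretization of a bounded subset of `ℝ^h`. -/
lemma exists_dyadic_grid {h : ℕ} (Y : Set (EuclideanSpace ℝ (Fin h))) (hY : Bornology.IsBounded Y) :
    ∃ (π : ℕ → Y → Y) (N : ℕ → Finset Y) (A B c : ℝ), 0 < B ∧ 0 ≤ c ∧ (∀ k, Measurable (π k)) ∧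
      (∀ k x, π k x ∈ N k) ∧ (∀ k, ((N k).card : ℝ) ≤ A * B ^ k) ∧
      ∀ k x, dist (π k x) x ≤ c * (1 / 2) ^ k := by
  classical
  rcases isEmpty_or_nonempty Y with hE | hne
  · exact ⟨fun _ => id, fun _ => ∅, 0, 1, 0, one_pos, le_rfl, fun _ => measurable_id,
      fun _ x => hE.elim x, fun _ => by simp, fun _ x => hE.elim x⟩
  obtain ⟨R₀, hR₀⟩ := hY.exists_norm_le
  obtain ⟨R, hR⟩ := exists_nat_ge R₀
  have hcoord : ∀ (x : Y) i, |(x : EuclideanSpace ℝ (Fin h)) i| ≤ R := fun x i =>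
    (PiLp.norm_apply_le (x : EuclideanSpace ℝ (Fin h)) i).trans ((hR₀ x x.2).trans hR)
  let cell : ℕ → Y → Fin h → ℤ := fun k x i => ⌊(2 : ℝ) ^ k * (x : EuclideanSpace ℝ (Fin h)) i⌋
  have hcell : ∀ k, Measurable (cell k) := by
    intro k
    refine measurable_pi_lambda _ fun i => Int.measurable_floor.comp ?_
    fun_prop
  let box : ℕ → Finset (Fin h → ℤ) := fun k =>
    Fintype.piFinset fun _ => Finset.Icc (-(R * 2 ^ k : ℤ)) (R * 2 ^ k : ℤ)
  have hbox : ∀ k x, cell k x ∈ box k := by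
    intro k x
    refine Fintype.mem_piFinset.2 fun i => Finset.mem_Icc.2 ?_
    have h1 := abs_le.1 (hcoord x i)
    have h2 : (0 : ℝ) < 2 ^ k := by positivity
    constructor
    · refine Int.le_floor.2 ?_
      push_cast
      nlinarith
    · have : (⌊(2 : ℝ) ^ k * (x : EuclideanSpace ℝ (Fin h)) i⌋ : ℝ) ≤ R * 2 ^ k :=
        (Int.floor_le _).trans (by nlinarith)
      simp only [cell]
      exact_mod_cast this
  -- Each point goes to a chosen point of `Y` in its own cell, so the grid stays inside `Y`. Cells
  -- missing `Y` contribute only a default point, harmless for the count. Measurability is free,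
  -- since cell indices are countable. The constant `√h` converts a coordinatewise error into a
  -- Euclidean one.
  refine ⟨fun k x => Function.invFun (cell k) (cell k x),
    fun k => (box k).image (Function.invFun (cell k)), (2 * R + 1) ^ h, 2 ^ h, √h,
    by positivity, by positivity, fun k => ?_, fun k x => ?_, fun k => ?_, fun k x => ?_⟩
  · exact (measurable_of_countable (Function.invFun (cell k))).comp (hcell k)
  · exact Finset.mem_image_of_mem _ (hbox k x)
  · have h1 : (box k).card = (2 * (R * 2 ^ k) + 1) ^ h := by
      simp only [box, Fintype.card_piFinset_const, Int.card_Icc]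
      congr 1
      have : ((R : ℤ) * 2 ^ k + 1 - -(R * 2 ^ k)) = ((2 * (R * 2 ^ k) + 1 : ℕ) : ℤ) := by
        push_cast; ring
      rw [this, Int.toNat_natCast]
    calc (((box k).image (Function.invFun (cell k))).card : ℝ) ≤ (box k).card := by
          exact_mod_cast Finset.card_image_le
      _ = (2 * (R * 2 ^ k) + 1) ^ h := by rw [h1]; push_cast; ring
      _ ≤ ((2 * R + 1) * 2 ^ k) ^ h := by
          gcongr
          have : (1 : ℝ) ≤ 2 ^ k := one_le_pow₀ (by norm_num)
          nlinarith
      _ = (2 * R + 1) ^ h * (2 ^ h) ^ k := by rw [mul_pow, ← pow_mul, ← pow_mul, mul_comm h k]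
  · have hsame : cell k (Function.invFun (cell k) (cell k x)) = cell k x :=
      Function.invFun_eq ⟨x, rfl⟩
    change dist (Function.invFun (cell k) (cell k x)) x ≤ _
    generalize Function.invFun (cell k) (cell k x) = y at hsame ⊢
    have hi : ∀ i, dist ((y : EuclideanSpace ℝ (Fin h)) i) ((x : EuclideanSpace ℝ (Fin h)) i)
        ≤ (1 / 2) ^ k := by
      intro i
      have h1 := Int.abs_sub_lt_one_of_floor_eq_floor (congrFun hsame i)
      rw [← mul_sub, abs_mul, abs_of_pos (by positivity : (0 : ℝ) < 2 ^ k)] at h1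
      rw [Real.dist_eq, one_div_pow, le_div_iff₀ (by positivity)]
      linarith
    rw [Subtype.dist_eq, EuclideanSpace.dist_eq]
    calc _ ≤ √(∑ _i : Fin h, ((1 / 2 : ℝ) ^ k) ^ 2) := by
          gcongr with i; exact hi i
      _ = √h * (1 / 2) ^ k := by
          rw [Finset.sum_const, Finset.card_univ, Fintype.card_fin, nsmul_eq_mul,
            Real.sqrt_mul (by positivity), Real.sqrt_sq (by positivity)]

/-! ### Second moments of integrated fields. -/

section SecondMoment

variable {Y S : Type*} [MeasurableSpace Y] [MeasurableSpace S] {μ : Measure Y} {P : Measure S}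

lemma ofReal_integral_sq {Z : S → ℝ} (hZ : MemLp Z 2 P) :
    ENNReal.ofReal (∫ s, Z s ^ 2 ∂P) = ∫⁻ s, ‖Z s‖ₑ ^ 2 ∂P := by
  rw [ofReal_integral_eq_lintegral_ofReal hZ.integrable_sq (ae_of_all _ fun s => sq_nonneg _)]
  refine lintegral_congr fun s => ?_
  rw [← sq_abs, ENNReal.ofReal_pow (abs_nonneg _), Real.enorm_eq_ofReal_abs]

lemma memLp_two_of_lintegral_sq_lt_top {Z : S → ℝ} (hZ : AEStronglyMeasurable Z P)
    (h : ∫⁻ s, ‖Z s‖ₑ ^ 2 ∂P < ∞) : MemLp Z 2 P := by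
  refine ⟨hZ, ?_⟩
  rw [eLpNorm_lt_top_iff_lintegral_rpow_enorm_lt_top (by norm_num) (by norm_num)]
  simpa using h

/-- Cauchy–Schwarz against the constant 1, read off from the comparison of `L¹` and `L²` norms. -/
lemma sq_lintegral_le (u : Y → ℝ) (hu : AEStronglyMeasurable u μ) :
    (∫⁻ η, ‖u η‖ₑ ∂μ) ^ 2 ≤ μ Set.univ * ∫⁻ η, ‖u η‖ₑ ^ 2 ∂μ := by
  have h := eLpNorm_le_eLpNorm_mul_rpow_measure_univ (p := 1) (q := 2) (by norm_num) hu
  rw [eLpNorm_one_eq_lintegral_enorm] at h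
  refine (pow_le_pow_left' h 2).trans (le_of_eq ?_)
  have h2 := eLpNorm_nnreal_pow_eq_lintegral (μ := μ) (f := u) (p := 2) (by norm_num)
  simp only [ENNReal.coe_ofNat, NNReal.coe_ofNat, ENNReal.rpow_ofNat] at h2
  rw [mul_pow, h2, mul_comm, ← ENNReal.rpow_natCast (μ Set.univ ^ _), ← ENNReal.rpow_mul]
  norm_num

/-- The second moment of an integrated random field. -/
lemma memLp_integral_and_sq_le [IsFiniteMeasure μ] [IsProbabilityMeasure P] {U : Y → S → ℝ}
    (hU : Measurable fun p : Y × S => U p.1 p.2) (hL : ∀ η, MemLp (U η) 2 P) {b : ℝ}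
    (hb : ∀ η, ∫ s, U η s ^ 2 ∂P ≤ b) :
    MemLp (fun s => ∫ η, U η s ∂μ) 2 P ∧
      ∫ s, (∫ η, U η s ∂μ) ^ 2 ∂P ≤ μ.real Set.univ ^ 2 * b := by
  rcases isEmpty_or_nonempty Y with hE | ⟨⟨η₀⟩⟩
  · have : μ = 0 := Measure.eq_zero_of_isEmpty μ
    subst this
    simp
  have hb0 : 0 ≤ b := (integral_nonneg fun s => sq_nonneg _).trans (hb η₀)
  have hmeas : StronglyMeasurable fun s => ∫ η, U η s ∂μ :=
    StronglyMeasurable.integral_prod_left hU.stronglyMeasurable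
  have hle : ∫⁻ s, ‖∫ η, U η s ∂μ‖ₑ ^ 2 ∂P ≤ ENNReal.ofReal (μ.real Set.univ ^ 2 * b) := by
    calc ∫⁻ s, ‖∫ η, U η s ∂μ‖ₑ ^ 2 ∂P
        ≤ ∫⁻ s, μ Set.univ * ∫⁻ η, ‖U η s‖ₑ ^ 2 ∂μ ∂P := by
          refine lintegral_mono fun s => ?_
          refine (pow_le_pow_left' (enorm_integral_le_lintegral_enorm _) 2).trans ?_
          exact sq_lintegral_le _
            (hU.comp (measurable_id.prodMk measurable_const)).aestronglyMeasurable
      _ = μ Set.univ * ∫⁻ η, ∫⁻ s, ‖U η s‖ₑ ^ 2 ∂P ∂μ := by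
          rw [lintegral_const_mul' _ _ (measure_ne_top _ _)]
          congr 1
          refine lintegral_lintegral_swap (Measurable.aemeasurable ?_)
          exact ((hU.comp measurable_swap).enorm).pow_const 2
      _ ≤ μ Set.univ * ∫⁻ _η, ENNReal.ofReal b ∂μ := by
          gcongr with η
          rw [← ofReal_integral_sq (hL η)]
          exact ENNReal.ofReal_le_ofReal (hb η)
      _ = ENNReal.ofReal (μ.real Set.univ ^ 2 * b) := by
          rw [lintegral_const, ENNReal.ofReal_mul (by positivity),
            ENNReal.ofReal_pow (by positivity), ofReal_measureReal]
          ring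
  have hJ : MemLp (fun s => ∫ η, U η s ∂μ) 2 P :=
    memLp_two_of_lintegral_sq_lt_top hmeas.aestronglyMeasurable
      (hle.trans_lt ENNReal.ofReal_lt_top)
  refine ⟨hJ, ?_⟩
  rw [← ofReal_integral_sq hJ] at hle
  exact (ENNReal.ofReal_le_ofReal_iff (by positivity)).1 hle

lemma memLp_mul_field {ι : Type*} {X : ι → S → ℝ} {κ α : ℝ} {a : ι → ℝ}
    (hL : ∀ η, MemLp (X η) 2 P)
    (hκ : ∀ η, ∫ s, X η s ^ 2 ∂P ≤ κ) (hα : ∀ η, |a η| ≤ α) (η : ι) :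
    MemLp (fun s => a η * X η s) 2 P ∧ ∫ s, (a η * X η s) ^ 2 ∂P ≤ α ^ 2 * κ := by
  refine ⟨(hL η).const_mul (a η), ?_⟩
  simp only [mul_pow, integral_const_mul]
  have h1 : a η ^ 2 ≤ α ^ 2 := by
    rw [← sq_abs]; exact pow_le_pow_left₀ (abs_nonneg _) (hα η) 2
  exact mul_le_mul h1 (hκ η) (integral_nonneg fun s => sq_nonneg _) (sq_nonneg _)

/-- Cruder than Cauchy–Schwarz, but only some finite Lipschitz constant is wanted later. -/
lemma abs_integral_mul_le {U V : S → ℝ} (hU : MemLp U 2 P) (hV : MemLp V 2 P) :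
    |∫ s, U s * V s ∂P| ≤ ∫ s, U s ^ 2 ∂P + ∫ s, V s ^ 2 ∂P := by
  rw [← integral_add hU.integrable_sq hV.integrable_sq]
  refine abs_integral_le_integral_abs.trans (integral_mono (MemLp.integrable_mul hU hV).abs
    (hU.integrable_sq.add hV.integrable_sq) fun s => ?_)
  simp only
  rw [abs_le]
  constructor <;> nlinarith [sq_nonneg (U s - V s), sq_nonneg (U s + V s)]

/-- A field sampled on a finite set integrates to a finite linear combination of its values. -/
lemma integral_mul_comp_eq_sum {π : Y → Y} (hπ : Measurable π) [MeasurableSingletonClass Y]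
    {N : Finset Y} {a : Y → ℝ} (hN : ∀ η, π η ∈ N) (hint : Integrable a μ) (x : Y → ℝ) :
    ∫ η, a η * x (π η) ∂μ = ∑ z ∈ N, (∫ η in π ⁻¹' {z}, a η ∂μ) * x z := by
  classical
  have hm : ∀ z, MeasurableSet (π ⁻¹' {z}) := fun z => hπ (measurableSet_singleton z)
  have h : ∀ η, a η * x (π η) = ∑ z ∈ N, (π ⁻¹' {z}).indicator a η * x z := by
    intro η
    rw [Finset.sum_eq_single (π η)]
    · simp
    · intro z _ hz
      rw [Set.indicator_of_notMem (by simpa using hz.symm), zero_mul]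
    · exact fun h => absurd (hN η) h
  simp only [h]
  rw [integral_finsetSum _ fun z _ => (hint.indicator (hm z)).mul_const _]
  refine Finset.sum_congr rfl fun z _ => ?_
  rw [integral_mul_const, integral_indicator (hm z)]

end SecondMoment

/-! ### Fubini for weighted integrals of a field, and their discretization. -/

section Field

variable {Y S : Type*} [MeasurableSpace Y] [MeasurableSpace S] {μ : Measure Y} {P : Measure S}
  [IsFiniteMeasure μ] [IsProbabilityMeasure P] {X : Y → S → ℝ} {κ α : ℝ} {a : Y → ℝ}

/-- Every exchange of expectation and integral rests on this. The uniform bound `κ` and the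
finiteness of `μ` put `X` in `L²(μ ⊗ P)`; so is `V`, and the bounded weight does no harm to the
product. -/
lemma integrable_mul_field_mul (hX : Measurable fun p : Y × S => X p.1 p.2)
    (hL : ∀ η, MemLp (X η) 2 P) (hκ : ∀ η, ∫ s, X η s ^ 2 ∂P ≤ κ)
    (ha : Measurable a) (hα : ∀ η, |a η| ≤ α) {V : S → ℝ} (hV : MemLp V 2 P) :
    Integrable (fun p : Y × S => a p.1 * (X p.1 p.2 * V p.2)) (μ.prod P) := by
  have hsq : Integrable (fun p : Y × S => X p.1 p.2 ^ 2) (μ.prod P) := by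
    refine (integrable_prod_iff (hX.pow_const 2).aestronglyMeasurable).2
      ⟨ae_of_all _ fun η => (hL η).integrable_sq, ?_⟩
    refine Integrable.of_bound (C := κ) ?_ (ae_of_all _ fun η => ?_)
    · exact (StronglyMeasurable.integral_prod_right
        (hX.pow_const 2).norm.stronglyMeasurable).aestronglyMeasurable
    · have : ∀ s, ‖X η s ^ 2‖ = X η s ^ 2 := fun s => Real.norm_of_nonneg (sq_nonneg _)
      simp only [this]
      rw [Real.norm_of_nonneg (integral_nonneg fun s => sq_nonneg _)]
      exact hκ η
  have hXL : MemLp (fun p : Y × S => X p.1 p.2) 2 (μ.prod P) :=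
    (memLp_two_iff_integrable_sq hX.aestronglyMeasurable).2 hsq
  exact (MemLp.integrable_mul hXL (hV.comp_snd μ)).bdd_mul (c := α)
    (ha.comp measurable_fst).aestronglyMeasurable (ae_of_all _ fun p => hα p.1)

lemma ae_integrable_mul_field (hX : Measurable fun p : Y × S => X p.1 p.2)
    (hL : ∀ η, MemLp (X η) 2 P) (hκ : ∀ η, ∫ s, X η s ^ 2 ∂P ≤ κ)
    (ha : Measurable a) (hα : ∀ η, |a η| ≤ α) :
    ∀ᵐ s ∂P, Integrable (fun η => a η * X η s) μ := by
  have := (integrable_mul_field_mul (μ := μ) hX hL hκ ha hα (memLp_const (1 : ℝ))).prod_left_ae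
  simpa using this

/-- Expectation commutes with the integration of the field against a weight. -/
lemma integral_integral_mul_field_mul (hX : Measurable fun p : Y × S => X p.1 p.2)
    (hL : ∀ η, MemLp (X η) 2 P) (hκ : ∀ η, ∫ s, X η s ^ 2 ∂P ≤ κ)
    (ha : Measurable a) (hα : ∀ η, |a η| ≤ α) {V : S → ℝ} (hV : MemLp V 2 P) :
    ∫ s, (∫ η, a η * X η s ∂μ) * V s ∂P = ∫ η, a η * ∫ s, X η s * V s ∂P ∂μ := by
  have hI := integrable_mul_field_mul (μ := μ) hX hL hκ ha hα hV
  calc ∫ s, (∫ η, a η * X η s ∂μ) * V s ∂P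
      = ∫ s, ∫ η, a η * (X η s * V s) ∂μ ∂P := by
        simp only [← integral_mul_const, mul_assoc]
    _ = ∫ η, ∫ s, a η * (X η s * V s) ∂P ∂μ := (integral_integral_swap hI).symm
    _ = _ := by simp only [integral_const_mul]

lemma integrable_mul_integral_field_mul (hX : Measurable fun p : Y × S => X p.1 p.2)
    (hL : ∀ η, MemLp (X η) 2 P) (hκ : ∀ η, ∫ s, X η s ^ 2 ∂P ≤ κ)
    (ha : Measurable a) (hα : ∀ η, |a η| ≤ α) {V : S → ℝ} (hV : MemLp V 2 P) :
    Integrable (fun η => a η * ∫ s, X η s * V s ∂P) μ := by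
  have := (integrable_mul_field_mul (μ := μ) hX hL hκ ha hα hV).integral_prod_left
  simpa only [integral_const_mul] using this

lemma memLp_weighted_integral (hX : Measurable fun p : Y × S => X p.1 p.2)
    (hL : ∀ η, MemLp (X η) 2 P) (hκ : ∀ η, ∫ s, X η s ^ 2 ∂P ≤ κ)
    (ha : Measurable a) (hα : ∀ η, |a η| ≤ α) :
    MemLp (fun s => ∫ η, a η * X η s ∂μ) 2 P ∧
      ∫ s, (∫ η, a η * X η s ∂μ) ^ 2 ∂P ≤ μ.real Set.univ ^ 2 * (α ^ 2 * κ) :=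
  memLp_integral_and_sq_le ((ha.comp measurable_fst).mul hX)
    (fun η => (memLp_mul_field hL hκ hα η).1) (fun η => (memLp_mul_field hL hκ hα η).2)

/-- Weighted integrals of a mean-square continuous field are `L²`-limits of their discretizations. -/
lemma tendsto_eLpNorm_discretization (hX : Measurable fun p : Y × S => X p.1 p.2)
    (hL : ∀ η, MemLp (X η) 2 P) (hκ : ∀ η, ∫ s, X η s ^ 2 ∂P ≤ κ)
    (ha : Measurable a) (hα : ∀ η, |a η| ≤ α) {π : ℕ → Y → Y} (hπ : ∀ k, Measurable (π k))
    {δ : ℕ → ℝ} (hδ : Tendsto δ atTop (𝓝 0))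
    (hπδ : ∀ k η, ∫ s, (X (π k η) s - X η s) ^ 2 ∂P ≤ δ k) :
    Tendsto (fun k => eLpNorm ((fun s => ∫ η, a η * X (π k η) s ∂μ)
      - fun s => ∫ η, a η * X η s ∂μ) 2 P) atTop (𝓝 0) := by
  have hXπ : ∀ k, Measurable fun p : Y × S => X (π k p.1) p.2 := fun k =>
    hX.comp (((hπ k).comp measurable_fst).prodMk measurable_snd)
  have hD := fun k => memLp_weighted_integral (μ := μ) (X := fun η s => X (π k η) s - X η s)
    ((hXπ k).sub hX) (fun η => (hL (π k η)).sub (hL η)) (hπδ k) ha hα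
  -- Only almost everywhere: subtracting the integrals needs integrable paths, which Fubini gives
  -- for almost every sample.
  have hae : ∀ k, ((fun s => ∫ η, a η * X (π k η) s ∂μ) - fun s => ∫ η, a η * X η s ∂μ)
      =ᵐ[P] fun s => ∫ η, a η * (X (π k η) s - X η s) ∂μ := by
    intro k
    filter_upwards [ae_integrable_mul_field (μ := μ) hX hL hκ ha hα,
      ae_integrable_mul_field (μ := μ) (X := fun η => X (π k η)) (hXπ k) (fun η => hL (π k η))
        (fun η => hκ (π k η)) ha hα] with s h1 h2
    simp only [Pi.sub_apply, mul_sub]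
    rw [integral_sub h2 h1]
  have hbound : Tendsto (fun k => ENNReal.ofReal (μ.real Set.univ ^ 2 * (α ^ 2 * δ k)) ^ (1 / 2 : ℝ))
      atTop (𝓝 0) := by
    have h1 : Tendsto (fun k => μ.real Set.univ ^ 2 * (α ^ 2 * δ k)) atTop (𝓝 0) := by
      simpa using (hδ.const_mul (α ^ 2)).const_mul (μ.real Set.univ ^ 2)
    have h2 := ENNReal.tendsto_ofReal h1
    rw [ENNReal.ofReal_zero] at h2
    have h3 := (ENNReal.continuous_rpow_const (y := (1 / 2 : ℝ))).tendsto 0 |>.comp h2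
    rwa [ENNReal.zero_rpow_of_pos (by norm_num)] at h3
  refine tendsto_of_tendsto_of_tendsto_of_le_of_le tendsto_const_nhds hbound
    (fun _ => zero_le) fun k => ?_
  simp only [eLpNorm_congr_ae (hae k)]
  rw [eLpNorm_eq_lintegral_rpow_enorm_toReal (by norm_num) (by norm_num)]
  simp only [ENNReal.toReal_ofNat, ENNReal.rpow_ofNat]
  rw [← ofReal_integral_sq (hD k).1]
  gcongr
  exact (hD k).2

end Field

/-! ### Centred Gaussian fields: increments, continuity, weighted integrals. -/

section Step

variable {S : Type*} [MeasurableSpace S] {P : Measure S}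

lemma IsCenteredGP.memLp {Y : Type*} {X : Y → S → ℝ} {K : Y → Y → ℝ} (h : IsCenteredGP P X K)
    (ζ : Y) : MemLp (X ζ) 2 P :=
  (h.gaussian.hasGaussianLaw_eval ζ).memLp_two

lemma IsCenteredGP.integral_sq {Y : Type*} {X : Y → S → ℝ} {K : Y → Y → ℝ}
    (h : IsCenteredGP P X K) (ζ : Y) : ∫ s, X ζ s ^ 2 ∂P = K ζ ζ := by
  rw [← h.cov_eq ζ ζ, covKernel]
  simp only [sq]

/-- Increments of a field whose covariance is Lipschitz in each argument. -/
lemma IsCenteredGP.integral_sub_sq_le {Y : Type*} [PseudoMetricSpace Y] {X : Y → S → ℝ}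
    {K : Y → Y → ℝ} (h : IsCenteredGP P X K) {L : ℝ≥0} (hK : IsLipschitzKernel L K) (x y : Y) :
    ∫ s, (X x s - X y s) ^ 2 ∂P ≤ 2 * L * dist x y := by
  have hxx : Integrable (fun s => X x s * X x s) P :=
    MemLp.integrable_mul (h.memLp x) (h.memLp x)
  have hxy : Integrable (fun s => X x s * X y s) P :=
    MemLp.integrable_mul (h.memLp x) (h.memLp y)
  have hyx : Integrable (fun s => X y s * X x s) P :=
    MemLp.integrable_mul (h.memLp y) (h.memLp x)
  have hyy : Integrable (fun s => X y s * X y s) P :=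
    MemLp.integrable_mul (h.memLp y) (h.memLp y)
  have heq : ∫ s, (X x s - X y s) ^ 2 ∂P = (K x x - K y x) - (K x y - K y y) := by
    rw [← h.cov_eq x x, ← h.cov_eq y x, ← h.cov_eq x y, ← h.cov_eq y y]
    simp only [covKernel]
    rw [← integral_sub hxx hyx, ← integral_sub hxy hyy]
    refine Eq.trans (integral_congr_ae (ae_of_all _ fun s => ?_))
      (integral_sub (hxx.sub hyx) (hxy.sub hyy))
    simp only
    ring
  have h1 := (hK.1 x).dist_le_mul x y
  have h2 := (hK.1 y).dist_le_mul x y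
  rw [Real.dist_eq] at h1 h2
  rw [heq]
  linarith [(abs_le.1 h1).2, (abs_le.1 h2).1]

variable [IsProbabilityMeasure P]

/-- Finite linear combinations of the values of a centred Gaussian process. -/
lemma IsCenteredGP.sum {Y : Type*} {X : Y → S → ℝ} {K : Y → Y → ℝ} (h : IsCenteredGP P X K)
    (I : Finset Y) (c : Y → ℝ) :
    HasGaussianLaw (fun s => ∑ i ∈ I, c i * X i s) P ∧ ∫ s, ∑ i ∈ I, c i * X i s ∂P = 0 := by
  refine ⟨by simpa using (h.gaussian.smul c).hasGaussianLaw_fun_sum (I := I), ?_⟩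
  rw [integral_finsetSum _ fun i _ => ((h.memLp i).integrable (by norm_num)).const_mul _]
  simp [integral_const_mul, h.mean_zero]

/-- A centred Gaussian field with Lipschitz covariance on a bounded subset of `ℝ^h` has a
continuous version. -/
lemma IsCenteredGP.hasContinuousVersion {h : ℕ} {Y : Set (EuclideanSpace ℝ (Fin h))}
    (hY : Bornology.IsBounded Y) {X : Y → S → ℝ} {K : Y → Y → ℝ} (hX : IsCenteredGP P X K)
    (hm : ∀ ζ, Measurable (X ζ)) {L : ℝ≥0} (hK : IsLipschitzKernel L K) :
    HasContinuousVersion P X := by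
  obtain ⟨π, N, A, B, c, hB, hc, -, hπN, hN, hπ⟩ := exists_dyadic_grid Y hY
  refine hasContinuousVersion_of_tail hm π N hB hc hπN hN hπ fun r hr => ?_
  -- Variance over squared threshold decays like `((1/2) / (3/4)²)ᵏ = (8/9)ᵏ`; the moment order
  -- turns this rate into `(8/9)^q < r`.
  obtain ⟨q, hq⟩ := exists_pow_lt_of_lt_one hr (by norm_num : (8 / 9 : ℝ) < 1)
  have hmom : 0 ≤ ∫ x, x ^ (2 * q) ∂gaussianReal 0 1 :=
    integral_nonneg fun x => by simp only [pow_mul, Pi.zero_apply]; positivity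
  refine ⟨(∫ x, x ^ (2 * q) ∂gaussianReal 0 1) * (2 * L * (2 * c + 1)) ^ q, by positivity,
    fun k x y hxy => ?_⟩
  have hsub : HasGaussianLaw (fun s => X x s - X y s) P := hX.gaussian.hasGaussianLaw_fun_sub
  have h0 : ∫ s, (X x s - X y s) ∂P = 0 := by
    rw [integral_sub ((hX.memLp x).integrable (by norm_num))
      ((hX.memLp y).integrable (by norm_num)), hX.mean_zero, hX.mean_zero, sub_zero]
  have hvar : ∫ s, (X x s - X y s) ^ 2 ∂P ≤ 2 * L * ((2 * c + 1) * (1 / 2) ^ k) :=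
    (hX.integral_sub_sq_le hK x y).trans (by gcongr)
  refine (measure_le_abs_le_of_gaussian hsub h0 hvar (by positivity : (0 : ℝ) < (3 / 4) ^ k)
    q).trans (ENNReal.ofReal_le_ofReal ?_)
  have hratio : 2 * L * ((2 * c + 1) * (1 / 2) ^ k) / ((3 / 4) ^ k) ^ 2
      = 2 * L * (2 * c + 1) * (8 / 9) ^ k := by
    have : (8 / 9 : ℝ) ^ k = (1 / 2) ^ k / ((3 / 4) ^ k) ^ 2 := by
      rw [← pow_mul, mul_comm k 2, pow_mul, ← div_pow]; norm_num
    rw [this]; ring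
  rw [hratio, mul_pow _ ((8 / 9 : ℝ) ^ k), ← pow_mul, mul_comm k q, pow_mul, ← mul_assoc]
  gcongr

variable {Y : Type*} [MeasurableSpace Y] [MeasurableSingletonClass Y] {μ : Measure Y}
  [IsFiniteMeasure μ]

/-- The sum of a weighted integral of a centred Gaussian field and of a linear combination of an
independent one is a centred Gaussian variable. -/
lemma hasGaussianLaw_weighted_integral_add {X w : Y → S → ℝ} {K W : Y → Y → ℝ}
    (hXm : Measurable fun p : Y × S => X p.1 p.2) (hX : IsCenteredGP P X K)
    (hw : IsCenteredGP P w W) (hind : IndepFun (fun s ζ => X ζ s) (fun s ζ => w ζ s) P)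
    {κ α : ℝ} (hκ : ∀ η, K η η ≤ κ) {a : Y → ℝ} (ha : Measurable a) (hα : ∀ η, |a η| ≤ α)
    {π : ℕ → Y → Y} (hπ : ∀ k, Measurable (π k)) {N : ℕ → Finset Y} (hN : ∀ k η, π k η ∈ N k)
    {δ : ℕ → ℝ} (hδ : Tendsto δ atTop (𝓝 0))
    (hπδ : ∀ k η, ∫ s, (X (π k η) s - X η s) ^ 2 ∂P ≤ δ k) (I : Finset Y) (c : Y → ℝ) :
    HasGaussianLaw (fun s => ∫ η, a η * X η s ∂μ + ∑ i ∈ I, c i * w i s) P ∧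
      ∫ s, (∫ η, a η * X η s ∂μ + ∑ i ∈ I, c i * w i s) ∂P = 0 := by
  have hκ' : ∀ η, ∫ s, X η s ^ 2 ∂P ≤ κ := fun η => (hX.integral_sq η).trans_le (hκ η)
  have haint : Integrable a μ :=
    Integrable.of_bound ha.aestronglyMeasurable α (ae_of_all _ hα)
  have hJ := memLp_weighted_integral (μ := μ) hXm hX.memLp hκ' ha hα
  have hlim := tendsto_eLpNorm_discretization (μ := μ) hXm hX.memLp hκ' ha hα hπ hδ hπδ
  simp only [fun k s => integral_mul_comp_eq_sum (hπ k) (hN k) haint (X · s)] at hlim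
  obtain ⟨hwG, hw0⟩ := hw.sum I c
  refine hasGaussianLaw_of_tendsto_eLpNorm
    (Z := fun k s => ∑ z ∈ N k, (∫ η in π k ⁻¹' {z}, a η ∂μ) * X z s + ∑ i ∈ I, c i * w i s)
    (fun k => ?_) (fun k => ?_) (hJ.1.add hwG.memLp_two) ?_
  · obtain ⟨hG, -⟩ := hX.sum (N k) fun z => ∫ η in π k ⁻¹' {z}, a η ∂μ
    have hφ : Measurable fun x : Y → ℝ => ∑ z ∈ N k, (∫ η in π k ⁻¹' {z}, a η ∂μ) * x z := by
      fun_prop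
    have hψ : Measurable fun x : Y → ℝ => ∑ i ∈ I, c i * x i := by fun_prop
    exact iIndepFun.hasGaussianLaw_fun_add hG hwG (hind.comp hφ hψ)
  · obtain ⟨hG, h0⟩ := hX.sum (N k) fun z => ∫ η in π k ⁻¹' {z}, a η ∂μ
    rw [integral_add hG.integrable hwG.integrable, h0, hw0, add_zero]
  · refine hlim.congr fun k => ?_
    congr 1
    funext s
    simp

end Step

lemma IsLipschitzKernel.exists_bound {Y : Type*} [PseudoMetricSpace Y] [CompactSpace Y] {L : ℝ≥0}
    {K : Y → Y → ℝ} (hK : IsLipschitzKernel L K) : ∃ B : ℝ, 0 ≤ B ∧ ∀ x y, |K x y| ≤ B := by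
  have hc : Continuous (Function.uncurry K) := (LipschitzWith.uncurry hK.1 hK.2).continuous
  obtain ⟨B, hB⟩ := isCompact_univ.exists_bound_of_continuousOn hc.continuousOn
  exact ⟨max B 0, le_max_right _ _, fun x y => (hB (x, y) (Set.mem_univ _)).trans (le_max_left _ _)⟩

lemma IsLipschitzKernel.measurable_right {Y : Type*} [PseudoMetricSpace Y] [MeasurableSpace Y]
    [OpensMeasurableSpace Y] {L : ℝ≥0} {Ω : Y → Y → ℝ} (hΩ : IsLipschitzKernel L Ω) (ζ : Y) :
    Measurable (Ω ζ) :=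
  (hΩ.2 ζ).continuous.measurable

/-- Uniform bounds for the second moments of `X` and for the kernel `Ω`. -/
lemma exists_transition_bounds {Y S : Type*} [PseudoMetricSpace Y] [CompactSpace Y]
    [MeasurableSpace S] {P : Measure S} {X : Y → S → ℝ} {Ω K : Y → Y → ℝ} {L LΩ : ℝ≥0}
    (hX : IsCenteredGP P X K) (hK : IsLipschitzKernel L K) (hΩ : IsLipschitzKernel LΩ Ω) :
    ∃ κ α : ℝ, 0 ≤ κ ∧ (∀ η, K η η ≤ κ) ∧ (∀ η, ∫ s, X η s ^ 2 ∂P ≤ κ) ∧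
      ∀ ζ η, |Ω ζ η| ≤ α := by
  obtain ⟨κ, hκ0, hκ⟩ := hK.exists_bound
  obtain ⟨α, -, hα⟩ := hΩ.exists_bound
  have hle : ∀ η, K η η ≤ κ := fun η => (le_abs_self _).trans (hκ η η)
  exact ⟨κ, α, hκ0, hle, fun η => (hX.integral_sq η).trans_le (hle η), hα⟩

/-! ### Covariance after one step. -/

section Transition

variable {S : Type*} [MeasurableSpace S] {P : Measure S} [IsProbabilityMeasure P]
  {Y : Type*} [PseudoMetricSpace Y] [CompactSpace Y] [MeasurableSpace Y] [OpensMeasurableSpace Y]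
  {μ : Measure Y} [IsFiniteMeasure μ] {X w : Y → S → ℝ} {Ω K W : Y → Y → ℝ} {L LΩ : ℝ≥0}

/-- Fubini twice: first with the whole second integral as the fixed square-integrable factor, then
with the value `X η₁`. -/
lemma integral_kernelOp_mul_kernelOp (hXm : Measurable fun p : Y × S => X p.1 p.2)
    (hX : IsCenteredGP P X K) (hK : IsLipschitzKernel L K) (hΩ : IsLipschitzKernel LΩ Ω)
    (ζ₁ ζ₂ : Y) :
    ∫ s, kernelOp μ Ω (X · s) ζ₁ * kernelOp μ Ω (X · s) ζ₂ ∂P = kernelConj μ Ω K ζ₁ ζ₂ := by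
  obtain ⟨κ, α, -, -, hκ, hα⟩ := exists_transition_bounds hX hK hΩ
  have hJ := memLp_weighted_integral (μ := μ) hXm hX.memLp hκ (hΩ.measurable_right ζ₂) (hα ζ₂)
  simp only [kernelOp]
  rw [integral_integral_mul_field_mul hXm hX.memLp hκ (hΩ.measurable_right ζ₁) (hα ζ₁) hJ.1]
  refine integral_congr_ae (ae_of_all _ fun η₁ => ?_)
  have h := integral_integral_mul_field_mul (μ := μ) hXm hX.memLp hκ (hΩ.measurable_right ζ₂)
    (hα ζ₂) (hX.memLp η₁)
  simp only [mul_comm (X η₁ _) (∫ η, _ ∂μ), h]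
  rw [← integral_const_mul]
  refine integral_congr_ae (ae_of_all _ fun η₂ => ?_)
  have hcov : ∫ s, X η₂ s * X η₁ s ∂P = K η₁ η₂ := by
    rw [← hX.cov_eq]; simp only [covKernel, mul_comm]
  simp only [hcov]
  ring

lemma integral_kernelOp_mul_eq_zero (hXm : Measurable fun p : Y × S => X p.1 p.2)
    (hX : IsCenteredGP P X K) (hK : IsLipschitzKernel L K) (hΩ : IsLipschitzKernel LΩ Ω)
    (hw : IsCenteredGP P w W) (hind : IndepFun (fun s ζ => X ζ s) (fun s ζ => w ζ s) P)
    (ζ₁ ζ₂ : Y) : ∫ s, kernelOp μ Ω (X · s) ζ₁ * w ζ₂ s ∂P = 0 := by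
  obtain ⟨κ, α, -, -, hκ, hα⟩ := exists_transition_bounds hX hK hΩ
  simp only [kernelOp]
  rw [integral_integral_mul_field_mul hXm hX.memLp hκ (hΩ.measurable_right ζ₁) (hα ζ₁)
    (hw.memLp ζ₂)]
  have h0 : ∀ η, ∫ s, X η s * w ζ₂ s ∂P = 0 := by
    intro η
    have hi : IndepFun (X η) (w ζ₂) P := hind.comp (measurable_pi_apply η) (measurable_pi_apply ζ₂)
    rw [hi.integral_fun_mul_eq_mul_integral (hX.memLp η).1 (hw.memLp ζ₂).1, hX.mean_zero, zero_mul]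
  simp [h0]

/-- Covariance of the next state. -/
lemma covKernel_transition (hXm : Measurable fun p : Y × S => X p.1 p.2)
    (hX : IsCenteredGP P X K) (hK : IsLipschitzKernel L K) (hΩ : IsLipschitzKernel LΩ Ω)
    (hw : IsCenteredGP P w W) (hind : IndepFun (fun s ζ => X ζ s) (fun s ζ => w ζ s) P)
    (ζ₁ ζ₂ : Y) :
    covKernel P (fun ζ s => kernelOp μ Ω (X · s) ζ + w ζ s) ζ₁ ζ₂
      = kernelConj μ Ω K ζ₁ ζ₂ + W ζ₁ ζ₂ := by
  obtain ⟨κ, α, -, -, hκ, hα⟩ := exists_transition_bounds hX hK hΩ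
  have hJ : ∀ ζ, MemLp (fun s => kernelOp μ Ω (X · s) ζ) 2 P := fun ζ =>
    (memLp_weighted_integral (μ := μ) hXm hX.memLp hκ (hΩ.measurable_right ζ) (hα ζ)).1
  have i1 : Integrable (fun s => kernelOp μ Ω (X · s) ζ₁ * kernelOp μ Ω (X · s) ζ₂) P :=
    MemLp.integrable_mul (hJ ζ₁) (hJ ζ₂)
  have i2 : Integrable (fun s => kernelOp μ Ω (X · s) ζ₁ * w ζ₂ s) P :=
    MemLp.integrable_mul (hJ ζ₁) (hw.memLp ζ₂)
  have i3 : Integrable (fun s => kernelOp μ Ω (X · s) ζ₂ * w ζ₁ s) P :=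
    MemLp.integrable_mul (hJ ζ₂) (hw.memLp ζ₁)
  have i4 : Integrable (fun s => w ζ₁ s * w ζ₂ s) P :=
    MemLp.integrable_mul (hw.memLp ζ₁) (hw.memLp ζ₂)
  have hexp : ∀ s, (kernelOp μ Ω (X · s) ζ₁ + w ζ₁ s) * (kernelOp μ Ω (X · s) ζ₂ + w ζ₂ s)
      = (kernelOp μ Ω (X · s) ζ₁ * kernelOp μ Ω (X · s) ζ₂ + kernelOp μ Ω (X · s) ζ₁ * w ζ₂ s)
        + (kernelOp μ Ω (X · s) ζ₂ * w ζ₁ s + w ζ₁ s * w ζ₂ s) := fun s => by ring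
  simp only [covKernel, hexp]
  refine (integral_add (i1.add i2) (i3.add i4)).trans ?_
  simp only [Pi.add_apply]
  rw [integral_add i1 i2, integral_add i3 i4,
    integral_kernelOp_mul_kernelOp hXm hX hK hΩ,
    integral_kernelOp_mul_eq_zero hXm hX hK hΩ hw hind,
    integral_kernelOp_mul_eq_zero hXm hX hK hΩ hw hind, ← hw.cov_eq ζ₁ ζ₂, covKernel]
  ring

/-- Conjugation by a Lipschitz kernel produces a Lipschitz kernel. -/
lemma exists_isLipschitzKernel_kernelConj (hXm : Measurable fun p : Y × S => X p.1 p.2)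
    (hX : IsCenteredGP P X K) (hK : IsLipschitzKernel L K) (hΩ : IsLipschitzKernel LΩ Ω) :
    ∃ L' : ℝ≥0, IsLipschitzKernel L' (kernelConj μ Ω K) := by
  obtain ⟨κ, α, hκ0, -, hκ, hα⟩ := exists_transition_bounds hX hK hΩ
  -- Symmetry is immediate from the form `E[(ΩX)(ζ₁) (ΩX)(ζ₂)]`, so one argument suffices for the
  -- Lipschitz estimate.
  have hsymm : ∀ ζ₁ ζ₂, kernelConj μ Ω K ζ₁ ζ₂ = kernelConj μ Ω K ζ₂ ζ₁ := by
    intro ζ₁ ζ₂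
    simp only [← integral_kernelOp_mul_kernelOp hXm hX hK hΩ, mul_comm]
  set B : ℝ := κ + μ.real Set.univ ^ 2 * (α ^ 2 * κ) with hB
  have hB0 : 0 ≤ B := by positivity
  have hlip : ∀ ζ₂, LipschitzWith (LΩ * B.toNNReal * (μ.real Set.univ).toNNReal)
      fun ζ₁ => kernelConj μ Ω K ζ₁ ζ₂ := by
    intro ζ₂
    refine LipschitzWith.of_dist_le_mul fun x y => ?_
    have hJ := memLp_weighted_integral (μ := μ) hXm hX.memLp hκ (hΩ.measurable_right ζ₂) (hα ζ₂)
    have hconj : ∀ x, kernelConj μ Ω K x ζ₂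
        = ∫ η, Ω x η * ∫ s, X η s * kernelOp μ Ω (X · s) ζ₂ ∂P ∂μ := fun x => by
      rw [← integral_kernelOp_mul_kernelOp hXm hX hK hΩ]
      exact integral_integral_mul_field_mul hXm hX.memLp hκ (hΩ.measurable_right x) (hα x) hJ.1
    have hi := fun x => integrable_mul_integral_field_mul (μ := μ) hXm hX.memLp hκ
      (hΩ.measurable_right x) (hα x) hJ.1
    rw [Real.dist_eq, hconj, hconj]
    simp only [kernelOp]
    rw [← integral_sub (hi x) (hi y)]
    have hbound : ∀ η, ‖Ω x η * (∫ s, X η s * ∫ η', Ω ζ₂ η' * X η' s ∂μ ∂P)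
        - Ω y η * (∫ s, X η s * ∫ η', Ω ζ₂ η' * X η' s ∂μ ∂P)‖ ≤ LΩ * dist x y * B := by
      intro η
      rw [← sub_mul, norm_mul]
      refine mul_le_mul ((hΩ.1 η).dist_le_mul x y) ?_ (norm_nonneg _) (by positivity)
      exact (abs_integral_mul_le (hX.memLp η) hJ.1).trans (add_le_add (hκ η) hJ.2)
    refine (norm_integral_le_of_norm_le_const (ae_of_all _ hbound)).trans (le_of_eq ?_)
    push_cast
    rw [Real.coe_toNNReal _ hB0, Real.coe_toNNReal _ measureReal_nonneg]
    ring
  exact ⟨_, hlip, fun ζ₁ => by simpa only [hsymm ζ₁] using hlip ζ₁⟩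

end Transition

/-- One step of the dynamics: the next state is again a centred Gaussian field, with covariance
`Ω K Ω' + W`, Lipschitz in each argument. -/
lemma IsCenteredGP.transition {h : ℕ} {Y : Set (EuclideanSpace ℝ (Fin h))} (hY : IsCompact Y)
    {S : Type*} [MeasurableSpace S] {P : Measure S} [IsProbabilityMeasure P] {μ : Measure Y}
    [IsFiniteMeasure μ] {X X' w : Y → S → ℝ} {Ω K W : Y → Y → ℝ} {L LΩ LW : ℝ≥0}
    (hXm : Measurable fun p : Y × S => X p.1 p.2) (hX : IsCenteredGP P X K)
    (hK : IsLipschitzKernel L K) (hΩ : IsLipschitzKernel LΩ Ω) (hW : IsLipschitzKernel LW W)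
    (hw : IsCenteredGP P w W) (hind : IndepFun (fun s ζ => X ζ s) (fun s ζ => w ζ s) P)
    (hdyn : ∀ ζ, ∀ᵐ s ∂P, X' ζ s = kernelOp μ Ω (X · s) ζ + w ζ s) :
    IsCenteredGP P X' (fun ζ₁ ζ₂ => kernelConj μ Ω K ζ₁ ζ₂ + W ζ₁ ζ₂) ∧
      ∃ L' : ℝ≥0, IsLipschitzKernel L' (fun ζ₁ ζ₂ => kernelConj μ Ω K ζ₁ ζ₂ + W ζ₁ ζ₂) := by
  classical
  have : CompactSpace Y := isCompact_iff_compactSpace.1 hY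
  obtain ⟨κ, α, -, hκK, hκ, hα⟩ := exists_transition_bounds hX hK hΩ
  obtain ⟨π, N, A, B, c, -, -, hπm, hπN, -, hπ⟩ := exists_dyadic_grid Y hY.isBounded
  have hδ : Tendsto (fun k : ℕ => 2 * L * (c * (1 / 2 : ℝ) ^ k)) atTop (𝓝 0) := by
    simpa using ((tendsto_pow_atTop_nhds_zero_of_lt_one (by norm_num : (0 : ℝ) ≤ 1 / 2)
      (by norm_num)).const_mul c).const_mul (2 * (L : ℝ))
  have hπδ : ∀ k η, ∫ s, (X (π k η) s - X η s) ^ 2 ∂P ≤ 2 * L * (c * (1 / 2 : ℝ) ^ k) :=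
    fun k η => (hX.integral_sub_sq_le hK _ _).trans (by gcongr; exact hπ k η)
  -- By linearity the weights collect into the single bounded weight `∑ i ∈ I, b i * Ω i η`, so all
  -- finite combinations reduce to one weighted integral plus noise.
  have hcomb : ∀ (I : Finset Y) (b : Y → ℝ), HasGaussianLaw (fun s => ∑ i ∈ I, b i * X' i s) P ∧
      ∫ s, ∑ i ∈ I, b i * X' i s ∂P = 0 := by
    intro I b
    have ha : Measurable fun η => ∑ i ∈ I, b i * Ω i η :=
      Finset.measurable_fun_sum _ fun i _ => (hΩ.measurable_right i).const_mul _
    have hα' : ∀ η, |∑ i ∈ I, b i * Ω i η| ≤ ∑ i ∈ I, |b i| * α := fun η =>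
      (Finset.abs_sum_le_sum_abs _ _).trans (Finset.sum_le_sum fun i _ => by
        rw [abs_mul]; exact mul_le_mul_of_nonneg_left (hα i η) (abs_nonneg _))
    obtain ⟨hG, h0⟩ := hasGaussianLaw_weighted_integral_add (μ := μ) hXm hX hw hind hκK ha hα'
      hπm hπN hδ hπδ I b
    have hae : (fun s => ∫ η, (∑ i ∈ I, b i * Ω i η) * X η s ∂μ + ∑ i ∈ I, b i * w i s)
        =ᵐ[P] fun s => ∑ i ∈ I, b i * X' i s := by
      have h1 : ∀ᵐ s ∂P, ∀ i ∈ I, Integrable (fun η => Ω i η * X η s) μ :=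
        (ae_ball_iff I.countable_toSet).2 fun i _ =>
          ae_integrable_mul_field hXm hX.memLp hκ (hΩ.measurable_right i) (hα i)
      have h2 : ∀ᵐ s ∂P, ∀ i ∈ I, X' i s = kernelOp μ Ω (X · s) i + w i s :=
        (ae_ball_iff I.countable_toSet).2 fun i _ => hdyn i
      filter_upwards [h1, h2] with s h1 h2
      have hsum : ∑ i ∈ I, b i * X' i s
          = ∑ i ∈ I, b i * kernelOp μ Ω (X · s) i + ∑ i ∈ I, b i * w i s := by
        rw [← Finset.sum_add_distrib]
        exact Finset.sum_congr rfl fun i hi => by rw [h2 i hi, mul_add]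
      rw [hsum]
      congr 1
      simp only [Finset.sum_mul, mul_assoc]
      rw [integral_finsetSum _ fun i hi => (h1 i hi).const_mul _]
      simp only [integral_const_mul, kernelOp]
    exact ⟨hG.congr hae, (integral_congr_ae hae).symm.trans h0⟩
  have hsingle : ∀ ζ, HasGaussianLaw (X' ζ) P ∧ ∫ s, X' ζ s ∂P = 0 := fun ζ => by
    simpa using hcomb {ζ} fun _ => 1
  refine ⟨⟨⟨fun I => ?_⟩, fun ζ => (hsingle ζ).2, fun ζ₁ ζ₂ => ?_⟩, ?_⟩
  · refine hasGaussianLaw_of_dual (aemeasurable_pi_lambda _ fun i => (hsingle i).1.aemeasurable)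
      fun Λ => ?_
    have hΛ : ∀ x : I → ℝ, Λ x = ∑ i, Λ (Pi.single i 1) * x i := by
      intro x
      conv_lhs => rw [pi_eq_sum_univ' x]
      simp [map_sum, mul_comm]
    -- The coordinates of the functional `Λ` on `ℝ^I`, extended by zero to weights on all of `Y`.
    have := (hcomb I fun y => if hy : y ∈ I then Λ (Pi.single ⟨y, hy⟩ 1) else 0).1
    convert this using 1
    funext s
    rw [hΛ, ← Finset.sum_coe_sort I]
    simp
  · rw [← covKernel_transition hXm hX hK hΩ hw hind]
    refine integral_congr_ae ?_
    filter_upwards [hdyn ζ₁, hdyn ζ₂] with s h1 h2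
    rw [h1, h2]
  · obtain ⟨L', hL'⟩ := exists_isLipschitzKernel_kernelConj (μ := μ) hXm hX hK hΩ
    exact ⟨L' + LW, fun y => (hL'.1 y).add (hW.1 y), fun x => (hL'.2 x).add (hW.2 x)⟩

instance isFiniteMeasure_lebesgueOn {h : ℕ} (Y : Set (EuclideanSpace ℝ (Fin h))) [CompactSpace Y] :
    IsFiniteMeasure (lebesgueOn Y) := by
  have hY : IsCompact Y := isCompact_iff_compactSpace.2 inferInstance
  refine ⟨?_⟩
  rw [lebesgueOn, comap_subtype_coe_apply hY.measurableSet, Set.image_univ, Subtype.range_coe]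
  exact hY.measure_lt_top

end LGDS

open LGDS in
theorem theorem2 {h : ℕ} (Y : Set (EuclideanSpace ℝ (Fin h))) (hY : IsCompact Y)
    {S : Type*} [MeasurableSpace S] (P : Measure S) [IsProbabilityMeasure P]
    (n : ℕ) (Ω W : Y → Y → ℝ) (f ω : ℕ → Y → S → ℝ)
    (hsys : IsLGDS (lebesgueOn Y) P n Ω W f ω)
    (LΩ LW : ℝ≥0) (hΩ : IsLipschitzKernel LΩ Ω) (hW : IsLipschitzKernel LW W)
    (C : ℝ) (hC : C ∈ Set.Ioo (0 : ℝ) 1) (hcontr : IsContractingKernel (lebesgueOn Y) C Ω)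
    (hWpsd : IsPosSemidefKernel W)
    (hΨpd : ∀ t ∈ Finset.Icc 1 n, IsPosDefKernel (covKernel P (f t)))
    (hΨ0 : ∃ L₀ : ℝ≥0, IsLipschitzKernel L₀ (covKernel P (f 0))) :
    -- `Ψ_t` is the covariance of a centred square-integrable field
    (∀ t ≤ n, ∀ ζ, MemLp (f t ζ) 2 P ∧ ∫ s, f t ζ s ∂P = 0) ∧
    -- `Ψ_{t+1} = Ω Ψ_t Ω' + W`
    (∀ t < n, ∀ ζ₁ ζ₂, covKernel P (f (t + 1)) ζ₁ ζ₂
      = kernelConj (lebesgueOn Y) Ω (covKernel P (f t)) ζ₁ ζ₂ + W ζ₁ ζ₂) ∧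
    -- `Ψ_t` is Lipschitz in both arguments
    (∀ t ≤ n, ∃ L : ℝ≥0, IsLipschitzKernel L (covKernel P (f t))) ∧
    -- `f_t` is almost surely continuous
    (∀ t ≤ n, HasContinuousVersion P (f t) ∧
      (IsSeparableField P (f t) → ∀ᵐ s ∂P, Continuous (fun ζ => f t ζ s))) := by
  have : CompactSpace Y := isCompact_iff_compactSpace.1 hY
  have hstate : ∀ t ≤ n, IsCenteredGP P (f t) (covKernel P (f t)) ∧
      ∃ L : ℝ≥0, IsLipschitzKernel L (covKernel P (f t)) := by
    intro t
    induction t with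
    | zero => exact fun _ => ⟨hsys.initial, hΨ0⟩
    | succ t ih =>
      intro ht
      obtain ⟨hGP, L, hL⟩ := ih (by omega)
      obtain ⟨hGP', L', hL'⟩ := hGP.transition hY (hsys.measurable t (by omega)) hL hΩ hW
        (hsys.noise t ht) (hsys.indep t ht) (hsys.dynamics t ht)
      rw [← funext₂ hGP'.cov_eq] at hL'
      exact ⟨⟨hGP'.gaussian, hGP'.mean_zero, fun _ _ => rfl⟩, L', hL'⟩
  refine ⟨fun t ht ζ => ⟨(hstate t ht).1.memLp ζ, (hstate t ht).1.mean_zero ζ⟩,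
    fun t ht ζ₁ ζ₂ => ?_, fun t ht => (hstate t ht).2, fun t ht => ?_⟩
  · obtain ⟨hGP, L, hL⟩ := hstate t ht.le
    exact (hGP.transition hY (hsys.measurable t ht.le) hL hΩ hW (hsys.noise t ht)
      (hsys.indep t ht) (hsys.dynamics t ht)).1.cov_eq ζ₁ ζ₂
  · obtain ⟨hGP, L, hL⟩ := hstate t ht
    have hver := hGP.hasContinuousVersion hY.isBounded
      (fun ζ => (hsys.measurable t ht).comp measurable_prodMk_left) hL
    exact ⟨hver, ae_continuous_of_isSeparableField hver⟩
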